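/- **Conventions.** A *formation* is a nonempty class of finite groups closed under homomorphic images and finite subdirect products. Let $A$ be a finite set with $|A|\ge 2$, $\widetilde A=A\cup A^{-1}$, and $F$ the free group on $A$, whose elements are reduced words over $\widetilde A$. A (finite) *$A$-generated group* is a finite group $G$ with a map $A\to G$ whose image generates $G$ (the map need not be injective); $[w]_G$ is the value of $w\in F$ in $G$, and we write $a$ for $[a]_G$. We write $H\twoheadrightarrow G$ if there is a group homomorphism $H\to G$ compatible with the maps from $A$. The Cayley graph $\Gamma(G)$ has vertex set $G$ and edges $(g,a)$, $g\in G$, $a\in\widetilde A$, running from $g$ to $ga$, with $(g,a)^{-1}=(ga,a^{-1})$; subgraphs are closed under endpoints and under inversion of edges. A *constellation* in $\Gamma(G)$ is a triple $(\Xi,g,\Theta)$ where $\Xi,\Theta$ are connected subgraphs, $1,g\in\Xi\cap\Theta$, and $1$ and $g$ lie in distinct connected components of $\Xi\cap\Theta$. An $A$-generated group $H$ *dissolves* it if $[u]_H\neq[v]_H$ for all $u,v\in F$ with $[u]_G=g=[v]_G$ such that the path in $\Gamma(G)$ starting at $1$ and labelled $u$ runs in $\Xi$ and the one labelled $v$ runs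 in $\Theta$. $H$ is a *dissolver* of $G$ if $H\twoheadrightarrow G$ and $H$ dissolves every constellation of $\Gamma(G)$. $H$ is a *weak dissolver* of $G$ if $H\twoheadrightarrow G$ and, for every $a\in\widetilde A$, $H$ dissolves $\Delta_a=(\Gamma(G)\setminus(1,a)^{\pm1},\,a,\,\{1,(1,a)^{\pm1},a\})$. If $[a]_G=1$, where $\Delta_a$ is not a constellation, the last condition is understood to say that $[u]_H\ne[a]_H$ for every $u\in F$ with $[u]_G=1$ whose path in $\Gamma(G)$ starting at $1$ avoids $(1,a)^{\pm1}$. A formation $\mathfrak F$ is *arboreous* (respectively *Hall*) if for every finite set $A$ with $|A|\ge2$, every $A$-generated group in $\mathfrak F$ has a dissolver (respectively a weak dissolver) that is an $A$-generated group in $\mathfrak F$. **Statement.** Every formation which contains the alternating group $\mathbb A_n$ for infinitely many $n$ is arboreous, and it is also Hall. In particular, the formation $\mathfrak F_e$ generated by all $\mathbb A_{2n}$ with $n\ge3$, the formation $\mathfrak F_o$ generated by all $\mathbb A_{2n+1}$ with $n\ge2$, and their join $\mathfrak F_e\vee\mathfrak F_o$ (the formation generated by $\mathfrak F_e\cup\mathfrak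 F_o$) are arboreous. -/

import Mathlib

/-- A graph in the sense of Serre: vertices `V`, oriented edges `E`, the subset of positive edges,
initial and terminal vertices, and the inversion of edges, which exchanges the positive and the
negative edges. Loops and multiple edges are allowed. -/
structure SerreGraph (V E : Type*) where
  pos : Set E
  init : E → V
  term : E → V
  inv : E → E
  inv_inv : ∀ e, inv (inv e) = e
  init_inv : ∀ e, init (inv e) = term e
  inv_pos : ∀ e, inv e ∈ pos ↔ e ∉ pos

namespace SerreGraph

variable {V E : Type*}

/-- `Γ.IsPath p u v`: the list `p` of edges is a path in `Γ` from `u` to `v`. -/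
def IsPath (Γ : SerreGraph V E) : List E → V → V → Prop
  | [], u, v => u = v
  | e :: p, u, v => Γ.init e = u ∧ Γ.IsPath p (Γ.term e) v

/-- A subgraph: sets of vertices and of edges, closed under incidence and inversion (closure under
terminal vertices follows). -/
structure Sub (Γ : SerreGraph V E) where
  verts : Set V
  edges : Set E
  init_mem : ∀ e ∈ edges, Γ.init e ∈ verts
  inv_mem : ∀ e ∈ edges, Γ.inv e ∈ edges

namespace Sub

variable {Γ : SerreGraph V E}

/-- The intersection of two subgraphs. -/
def inter (Ξ Θ : Γ.Sub) : Γ.Sub where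
  verts := Ξ.verts ∩ Θ.verts
  edges := Ξ.edges ∩ Θ.edges
  init_mem e he := ⟨Ξ.init_mem e he.1, Θ.init_mem e he.2⟩
  inv_mem e he := ⟨Ξ.inv_mem e he.1, Θ.inv_mem e he.2⟩

/-- `u` and `v` are vertices of the subgraph in the same connected component of it. -/
def Joined (Ξ : Γ.Sub) (u v : V) : Prop :=
  u ∈ Ξ.verts ∧ v ∈ Ξ.verts ∧ ∃ p : List E, Γ.IsPath p u v ∧ ∀ e ∈ p, e ∈ Ξ.edges

/-- Any two vertices of the subgraph can be joined by a path in it. -/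
def Connected (Ξ : Γ.Sub) : Prop :=
  ∀ u ∈ Ξ.verts, ∀ v ∈ Ξ.verts, Ξ.Joined u v

end Sub

/-- `Γ ∖ e^{±1}`: all vertices, and all edges except `e` and its inverse. -/
def deleteEdge (Γ : SerreGraph V E) (e : E) : Γ.Sub where
  verts := Set.univ
  edges := {f | f ≠ e ∧ f ≠ Γ.inv e}
  init_mem _ _ := Set.mem_univ _
  inv_mem f hf := by
    refine ⟨fun h => hf.2 ?_, fun h => hf.1 ?_⟩
    · rw [← h, Γ.inv_inv]
    · rw [← Γ.inv_inv f, h, Γ.inv_inv]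

/-- The subgraph spanned by the geometric edge `e^{±1}`. -/
def edgeSub (Γ : SerreGraph V E) (e : E) : Γ.Sub where
  verts := {Γ.init e, Γ.term e}
  edges := {e, Γ.inv e}
  init_mem f hf := by
    rcases hf with rfl | rfl
    · exact Or.inl rfl
    · exact Or.inr (Γ.init_inv e)
  inv_mem f hf := by
    rcases hf with rfl | rfl
    · exact Or.inr rfl
    · exact Or.inl (Γ.inv_inv e)

/-- `(Ξ, g, Θ)` is a constellation in the finite graph `Γ` with distinguished vertex `o`: `Ξ` and
`Θ` are connected subgraphs which both contain `o` and `g`, and `o` and `g` lie in distinct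
connected components of the intersection of `Ξ` and `Θ`. -/
def IsConstellation (Γ : SerreGraph V E) (o : V) (Ξ : Γ.Sub) (g : V) (Θ : Γ.Sub) : Prop :=
  Ξ.Connected ∧ Θ.Connected ∧
    o ∈ (Ξ.inter Θ).verts ∧ g ∈ (Ξ.inter Θ).verts ∧ ¬ (Ξ.inter Θ).Joined o g

end SerreGraph

/-- A finite `A`-generated group: a finite group with a map from `A` whose image generates it. -/
structure AGroup (A : Type*) where
  carrier : Type
  [group : Group carrier]
  [finite : Finite carrier]
  gen : A → carrier
  closure_gen : Subgroup.closure (Set.range gen) = ⊤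

attribute [instance] AGroup.group AGroup.finite

namespace AGroup

variable {A : Type*}

/-- The value `[w]_G` of `w` in `G`. -/
def val (G : AGroup A) (w : FreeGroup A) : G.carrier := FreeGroup.lift G.gen w

/-- The value in `G` of a letter: `(a, true)` stands for `a`, and `(a, false)` for its inverse. -/
def letter (G : AGroup A) (x : A × Bool) : G.carrier := G.val (FreeGroup.mk [x])

theorem letter_not (G : AGroup A) (x : A × Bool) :
    G.letter (x.1, !x.2) = (G.letter x)⁻¹ := by
  rcases x with ⟨a, _ | _⟩ <;> simp [letter, val]

/-- The Cayley graph of `G`: the edge `(g, x)` runs from `g` to `g x`, its inverse is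
`(g x, x⁻¹)`. -/
def cayley (G : AGroup A) : SerreGraph G.carrier (G.carrier × (A × Bool)) where
  pos := {e | e.2.2 = true}
  init e := e.1
  term e := e.1 * G.letter e.2
  inv e := (e.1 * G.letter e.2, (e.2.1, !e.2.2))
  inv_inv e := by
    rcases e with ⟨g, x⟩
    simp [letter_not]
  init_inv _ := rfl
  inv_pos e := by simp

/-- The edges of the path in the Cayley graph of `G` which starts at `g` and has a given label. -/
def pathFrom (G : AGroup A) : G.carrier → List (A × Bool) → List (G.carrier × (A × Bool))
  | _, [] => []
  | g, x :: w => (g, x) :: G.pathFrom (g * G.letter x) w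

open Classical in
/-- The path in the Cayley graph of `G` which starts at `1` and is labelled by the reduced word `w`
runs entirely in the subgraph `Ξ`. -/
def RunsIn (G : AGroup A) (w : FreeGroup A) (Ξ : G.cayley.Sub) : Prop :=
  1 ∈ Ξ.verts ∧ ∀ e ∈ G.pathFrom 1 w.toWord, e ∈ Ξ.edges

/-- `H` dissolves `(Ξ, g, Θ)`. -/
def Dissolves (H G : AGroup A) (Ξ : G.cayley.Sub) (g : G.carrier) (Θ : G.cayley.Sub) : Prop :=
  ∀ u v : FreeGroup A, G.val u = g → G.val v = g → G.RunsIn u Ξ → G.RunsIn v Θ →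
    H.val u ≠ H.val v

/-- `H` dissolves every constellation of the Cayley graph of `G`. -/
def IsPredissolver (H G : AGroup A) : Prop :=
  ∀ (Ξ : G.cayley.Sub) (g : G.carrier) (Θ : G.cayley.Sub),
    G.cayley.IsConstellation 1 Ξ g Θ → H.Dissolves G Ξ g Θ

/-- There is a canonical morphism from `H` onto `G`. -/
def MapsOnto (H G : AGroup A) : Prop :=
  ∃ χ : H.carrier →* G.carrier, ∀ a, χ (H.gen a) = G.gen a

def IsDissolver (H G : AGroup A) : Prop := H.IsPredissolver G ∧ H.MapsOnto G

/-- `H` dissolves, for every letter or inverse letter `a`, the constellation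
`Δ_a = (Γ(G) ∖ (1, a)^{±1}, a, {1, (1, a)^{±1}, a})`.

If `a = 1` in `G`, then `(1, a)` is a loop and `Δ_a` is not a constellation (and `u = v = 1` would
be a pair of words for it that no group separates). Dissolving it then means, as in the case
`a ≠ 1`, that no word whose path avoids `(1, a)^{±1}` has the same value in `H` as `a`; when `H`
maps onto `G` with kernel `N`, this is in both cases equivalent to the disconnectedness of
`Γ(H) ∖ N(1, a)^{±1}`. -/
def IsWeakPredissolver (H G : AGroup A) : Prop :=
  ∀ a : A × Bool,
    (G.letter a ≠ 1 →
      H.Dissolves G (G.cayley.deleteEdge (1, a)) (G.letter a) (G.cayley.edgeSub (1, a))) ∧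
    (G.letter a = 1 →
      ∀ u : FreeGroup A, G.val u = 1 → G.RunsIn u (G.cayley.deleteEdge (1, a)) →
        H.val u ≠ H.letter a)

def IsWeakDissolver (H G : AGroup A) : Prop := H.IsWeakPredissolver G ∧ H.MapsOnto G

end AGroup

/-- A formation: a nonempty class of finite groups which is closed under homomorphic images (in
particular under isomorphisms) and under subdirect products of two groups (hence under finite
subdirect products). Every finite group is isomorphic to one in `Type`. -/
structure Formation where
  Mem : (G : Type) → [Group G] → Prop
  finite_of_mem : ∀ (G : Type) [Group G], Mem G → Finite G
  nonempty : ∃ (G : Type) (_ : Group G), Mem G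
  image : ∀ (G H : Type) [Group G] [Group H] (f : G →* H),
    Function.Surjective f → Mem G → Mem H
  subdirect : ∀ (G H K : Type) [Group G] [Group H] [Group K] (f : G →* H) (k : G →* K),
    Function.Surjective f → Function.Surjective k → (∀ g, f g = 1 → k g = 1 → g = 1) →
    Mem H → Mem K → Mem G

namespace Formation

/-- The `A`-generated members of a formation. -/
def members (𝔉 : Formation) (A : Type) : Set (AGroup A) := {G | 𝔉.Mem G.carrier}

/-- For every alphabet `A` with at least two letters, every `A`-generated member has a dissolver
among the `A`-generated members. -/
def Arboreous (𝔉 : Formation) : Prop :=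
  ∀ (A : Type) [Finite A] [Nontrivial A],
    ∀ G ∈ 𝔉.members A, ∃ H ∈ 𝔉.members A, H.IsDissolver G

/-- For every alphabet `A` with at least two letters, every `A`-generated member has a weak
dissolver among the `A`-generated members. -/
def Hall (𝔉 : Formation) : Prop :=
  ∀ (A : Type) [Finite A] [Nontrivial A],
    ∀ G ∈ 𝔉.members A, ∃ H ∈ 𝔉.members A, H.IsWeakDissolver G

/-- The formation of all finite groups. -/
def all : Formation where
  Mem G _ := Finite G
  finite_of_mem _ _ h := h
  nonempty := ⟨Unit, inferInstance, inferInstance⟩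
  image _ _ _ _ f hf h := @Finite.of_surjective _ _ h f hf
  subdirect G H K _ _ _ f k _ _ hfk hH hK := by
    have hi : Function.Injective (f.prod k) := by
      rw [injective_iff_map_eq_one]
      intro g hg
      exact hfk g (congrArg Prod.fst hg) (congrArg Prod.snd hg)
    have : Finite (H × K) := @Finite.instProd _ _ hH hK
    exact Finite.of_injective _ hi

/-- The formation generated by a class `S` of finite groups: the intersection of all formations
containing it. -/
def generatedBy (S : (G : Type) → [Group G] → Prop)
    (hS : ∀ (G : Type) [Group G], S G → Finite G) : Formation where
  Mem G _ := ∀ 𝔉 : Formation, (∀ (X : Type) [Group X], S X → 𝔉.Mem X) → 𝔉.Mem G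
  finite_of_mem _ _ h := h all hS
  nonempty := by
    refine ⟨Unit, inferInstance, fun 𝔉 _ => ?_⟩
    obtain ⟨G, _, hG⟩ := 𝔉.nonempty
    exact 𝔉.image G Unit 1 (fun x => ⟨1, Subsingleton.elim _ _⟩) hG
  image G H _ _ f hf h 𝔉 h𝔉 := 𝔉.image G H f hf (h 𝔉 h𝔉)
  subdirect G H K _ _ _ f k hf hk hfk hH hK 𝔉 h𝔉 :=
    𝔉.subdirect G H K f k hf hk hfk (hH 𝔉 h𝔉) (hK 𝔉 h𝔉)

/-- The join of two formations: the formation generated by their union. -/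
def join (𝔉 𝔊 : Formation) : Formation :=
  generatedBy (fun G _ => 𝔉.Mem G ∨ 𝔊.Mem G)
    (fun G _ h => h.elim (𝔉.finite_of_mem G) (𝔊.finite_of_mem G))

/-- The formation generated by the alternating groups of degree `2n`, `n ≥ 3`. -/
def evenAlternating : Formation :=
  generatedBy (fun G _ => ∃ n : ℕ, 3 ≤ n ∧ Nonempty (G ≃* alternatingGroup (Fin (2 * n))))
    (fun _ _ h => by
      obtain ⟨n, -, ⟨e⟩⟩ := h
      exact Finite.of_equiv _ e.symm.toEquiv)

/-- The formation generated by the alternating groups of degree `2n + 1`, `n ≥ 2`. -/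
def oddAlternating : Formation :=
  generatedBy (fun G _ => ∃ n : ℕ, 2 ≤ n ∧ Nonempty (G ≃* alternatingGroup (Fin (2 * n + 1))))
    (fun _ _ h => by
      obtain ⟨n, -, ⟨e⟩⟩ := h
      exact Finite.of_equiv _ e.symm.toEquiv)

end Formation

/-! There are finitely many constellations, and a group mapping onto a dissolver of one of them
dissolves it too. A subdirect product with `G` therefore reduces the problem to a single
constellation (Ξ, g, Θ).

Let f be 0 on the component of 1 in Ξ ∩ Θ and 1 elsewhere. Give the edges of Ξ the coboundary of f
as voltage in ℤ/2, and all other edges voltage 0. Since f is constant along common edges, Θ lifts to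
the zero section of the resulting twofold cover of the Cayley graph, and Ξ lifts to the graph of f.
From (1, 0), words running in Ξ to g end at (g, 1), words running in Θ to g end at (g, 0): the
action on the cover separates them.

The group of this action need not lie in the formation. But some edge of the cover is used by
neither lift. Removing it leaves room to attach a long tail and to complete the partial permutations
to generators of the alternating group of every large degree (`exists_alternating_extension`),
without disturbing the lifts. Generation follows from Jordan's theorem on primitive groups with a
3-cycle. When a letter is trivial in `G`, the Hall property uses the same extension for `G` acting
on itself, with the loop at 1 removed. -/

/-! ### Permutations and a criterion for containing the alternating group -/

theorem perm_apply_inv_self {X : Type*} (f : Equiv.Perm X) (x : X) : f (f⁻¹ x) = x :=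
  f.apply_symm_apply x

theorem perm_inv_apply_self {X : Type*} (f : Equiv.Perm X) (x : X) : f⁻¹ (f x) = x :=
  f.symm_apply_apply x

open Equiv in
/-- A map which is injective away from two points agrees there with an even permutation. -/
theorem exists_sign_eq_one_extending {X : Type*} [Fintype X] [DecidableEq X] (f : X → X) {p q : X}
    (hpq : p ≠ q) (hf : Set.InjOn f {x | x ≠ p ∧ x ≠ q}) :
    ∃ σ : Perm X, Perm.sign σ = 1 ∧ ∀ x, x ≠ p → x ≠ q → σ x = f x := by
  obtain ⟨g, hg⟩ := Finset.exists_equiv_extend_of_card_eq (t := (Finset.univ : Finset X)) (f := f)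
    (s := {x | x ≠ p ∧ x ≠ q}) (by simp) (Finset.subset_univ _) (by simpa using hf)
  let τ : Perm X := g.trans (Equiv.subtypeUnivEquiv (fun x => Finset.mem_univ x))
  have hτ : ∀ x, x ≠ p → x ≠ q → τ x = f x := fun x h₁ h₂ => hg x (by simp [h₁, h₂])
  rcases Int.units_eq_one_or (Perm.sign τ) with h | h
  · exact ⟨τ, h, hτ⟩
  · refine ⟨τ * swap p q, by simp [h, Perm.sign_swap hpq], fun x h₁ h₂ => ?_⟩
    rw [Perm.mul_apply, swap_apply_of_ne_of_ne h₁ h₂, hτ x h₁ h₂]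

open Equiv in
/-- If the supports of two permutations meet in a single point, their commutator is a `3`-cycle. -/
theorem commutator_eq_swap_mul_swap {X : Type*} [DecidableEq X] {f g : Perm X} {p : X}
    (hf : f p ≠ p) (hg : g p ≠ p) (h : ∀ x, x ≠ p → f x = x ∨ g x = x) :
    f * g * f⁻¹ * g⁻¹ = swap p (g p) * swap p (f p) := by
  have fi : ∀ x, f x = x → f⁻¹ x = x := fun x hx => by rw [Perm.inv_eq_iff_eq, hx]
  have gi : ∀ x, g x = x → g⁻¹ x = x := fun x hx => by rw [Perm.inv_eq_iff_eq, hx]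
  have hgf : g (f p) = f p := (h _ hf).resolve_left fun e => hf (f.injective e)
  have hfg : f (g p) = g p := (h _ hg).resolve_right fun e => hg (g.injective e)
  have hfg' : g p ≠ f p := fun e => hg (g.injective (by rw [e, hgf]))
  have hfip : f⁻¹ p ≠ p := fun e => hf (by rw [Perm.inv_eq_iff_eq] at e; exact e.symm)
  have hgip : g⁻¹ p ≠ p := fun e => hg (by rw [Perm.inv_eq_iff_eq] at e; exact e.symm)
  ext x
  simp only [Perm.mul_apply]
  by_cases h1 : x = p
  · subst h1
    have : f (g⁻¹ x) = g⁻¹ x := (h _ hgip).resolve_right fun e => hgip (by simpa using e.symm)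
    rw [fi _ this, swap_apply_left, swap_apply_of_ne_of_ne hf hfg'.symm]
    simp
  by_cases h2 : x = f p
  · subst h2
    rw [gi _ hgf, swap_apply_right, swap_apply_left]
    simp [hfg]
  by_cases h3 : x = g p
  · subst h3
    have : g (f⁻¹ p) = f⁻¹ p := (h _ hfip).resolve_left fun e => hfip (by simpa using e.symm)
    rw [swap_apply_of_ne_of_ne hg hfg', swap_apply_right]
    rw [perm_inv_apply_self, this, perm_apply_inv_self]
  rw [swap_apply_of_ne_of_ne h1 h2, swap_apply_of_ne_of_ne h1 h3]
  by_cases hx : g x = x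
  · have h4 : f⁻¹ x ≠ p := fun e => h2 (by rw [← e]; simp)
    rw [gi _ hx]
    rcases h _ h4 with h5 | h5
    · rw [perm_apply_inv_self] at h5
      rw [← h5, hx]
      conv_lhs => rw [h5, perm_apply_inv_self]
    · rw [h5, perm_apply_inv_self]
  · have h4 : g⁻¹ x ≠ p := fun e => h3 (by rw [← e]; simp)
    have h5 : f (g⁻¹ x) = g⁻¹ x := (h _ h4).resolve_right fun e => hx <| by
      rw [perm_apply_inv_self] at e
      conv_lhs => rw [e, perm_apply_inv_self]
    rw [fi _ h5]
    simpa using (h x h1).resolve_right hx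

-- By Jordan's theorem only primitivity is needed. Let a block B contain p and a second point q ≠ a
-- p. The 3-cycle p → r → a p either fixes q or sends p to q, so it preserves B, and a p ∈ B. Then
-- `a` preserves B, so B contains S, more than half of all points.
open Equiv MulAction Pointwise in
theorem alternatingGroup_le_of_threeCycle {X : Type*} [Fintype X] [DecidableEq X]
    (H : Subgroup (Perm X)) [IsPretransitive H X] {a : Perm X} (ha : a ∈ H) {p r : X}
    (hap : a p ≠ p) (hrp : r ≠ p) (hra : r ≠ a p) (ht : swap p (a p) * swap p r ∈ H)
    (S : Set X) (hS : ∀ x ∈ S, ∃ i : ℤ, (a ^ i) p = x) (hcard : Fintype.card X < S.ncard * 2) :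
    alternatingGroup X ≤ H := by
  refine Perm.alternatingGroup_le_of_isPreprimitive_of_isThreeCycle_mem ?_
    (Perm.isThreeCycle_swap_mul_swap_same hap.symm hrp.symm hra.symm) ht
  refine IsPreprimitive.of_isTrivialBlock_base p fun {B} hpB hB => ?_
  by_cases hs : B.Subsingleton
  · exact Or.inl hs
  right
  rw [Set.not_subsingleton_iff] at hs
  obtain ⟨q, hq, hqp⟩ := hs.exists_ne p
  let t : H := ⟨_, ht⟩
  have htp : t • p = r := by
    change (swap p (a p) * swap p r) p = r
    rw [Perm.mul_apply, swap_apply_left, swap_apply_of_ne_of_ne hrp hra]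
  have htr : t • r = a p := by
    change (swap p (a p) * swap p r) r = a p
    rw [Perm.mul_apply, swap_apply_right, swap_apply_left]
  have key : a p ∈ B := by
    by_cases hqa : q = a p
    · exact hqa ▸ hq
    have htB : t • B = B := by
      by_cases hqr : q = r
      · exact hB.smul_eq_of_mem hpB (by rw [htp, ← hqr]; exact hq)
      · refine hB.smul_eq_of_mem hq ?_
        have : t • q = q := by
          change (swap p (a p) * swap p r) q = q
          rw [Perm.mul_apply, swap_apply_of_ne_of_ne hqp hqr, swap_apply_of_ne_of_ne hqp hqa]
        rwa [this]
    have h1 : t • p ∈ B := htB ▸ Set.smul_mem_smul_set hpB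
    have h2 : t • t • p ∈ B := htB ▸ Set.smul_mem_smul_set h1
    rwa [htp, htr] at h2
  have haB : (⟨a, ha⟩ : H) ∈ stabilizer H B := hB.smul_eq_of_mem hpB key
  refine hB.eq_univ_of_card_lt ?_
  rw [Nat.card_eq_fintype_card]
  refine hcard.trans_le (Nat.mul_le_mul_right _ (Set.ncard_le_ncard fun x hx => ?_))
  obtain ⟨i, rfl⟩ := hS x hx
  have h3 : (⟨a, ha⟩ : H) ^ i • B = B := (stabilizer H B).zpow_mem haB i
  have h4 : (⟨a, ha⟩ : H) ^ i • p ∈ B := h3 ▸ Set.smul_mem_smul_set hpB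
  exact h4

/-! ### Completing a partial action to generators of an alternating group -/

open Equiv MulAction in
/-- A transitive family of permutations of a finite set extends, away from one prescribed edge, to
a family which generates the alternating group on any sufficiently large number of points. -/
theorem exists_alternating_extension {A X₀ : Type} [Nontrivial A] [Fintype X₀] (π : A → Perm X₀)
    (hπ : ∀ S : Set X₀, S.Nonempty → (∀ l x, x ∈ S ↔ π l x ∈ S) → S = Set.univ)
    (a : A) (x₀ : X₀) :
    ∃ N : ℕ, ∀ n ≥ N, ∃ (X : Type) (_ : Fintype X) (_ : DecidableEq X) (ι : X₀ → X)
      (σ : A → Perm X), Fintype.card X = n ∧ Function.Injective ι ∧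
      (∀ l x, (l, x) ≠ (a, x₀) → σ l (ι x) = ι (π l x)) ∧ σ a (ι x₀) ∉ Set.range ι ∧
      Subgroup.closure (Set.range σ) = alternatingGroup X := by
  classical
  set m := Fintype.card X₀ with hm
  set M := (m + 3).factorial with hM
  have hM0 : 0 < M := Nat.factorial_pos _
  -- The tail `Fin L` must hold two intervals of length M + 1 sharing one point, and be longer than
  -- the rest, m + 3 points.
  refine ⟨2 * M + 2 * (m + 3) + 2, fun n hn => ?_⟩
  obtain ⟨L, rfl⟩ : ∃ L, n = m + 3 + L := ⟨n - (m + 3), by omega⟩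
  have hL : 2 * M + 2 + (m + 3) ≤ L := by omega
  have : NeZero L := ⟨by omega⟩
  let ι : X₀ → ((X₀ ⊕ Fin 3) ⊕ Fin L) :=
    fun x => Sum.inl (Sum.inl x)
  let P : Fin 3 → ((X₀ ⊕ Fin 3) ⊕ Fin L) :=
    fun i => Sum.inl (Sum.inr i)
  let z : Fin L → ((X₀ ⊕ Fin 3) ⊕ Fin L) :=
    Sum.inr
  -- the distinguished generator
  let f : ((X₀ ⊕ Fin 3) ⊕ Fin L) → ((X₀ ⊕ Fin 3) ⊕ Fin L)
    | Sum.inl (Sum.inl x) => if x = x₀ then P 0 else ι (π a x)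
    | Sum.inl (Sum.inr _) => z ⟨0, by omega⟩
    | Sum.inr i => if h : (i : ℕ) + 1 < L then z ⟨i + 1, h⟩ else P 1
  obtain ⟨α, hα1, hαf⟩ := exists_sign_eq_one_extending f (p := P 1) (q := P 2)
    (by simp [P]) (by
      rintro ((x | i) | i) hx ((y | j) | j) hy hxy
      · simp only [f, ι, P] at hxy
        split_ifs at hxy
        all_goals simp_all
      iterate 3
        · simp only [f, ι, P, z] at hxy
          split_ifs at hxy
          all_goals simp_all
      · simp only [P, Set.mem_ofPred_eq, ne_eq, Sum.inl.injEq, Sum.inr.injEq] at hx hy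
        have h1 : i = 0 := by omega
        have h2 : j = 0 := by omega
        rw [h1, h2]
      iterate 3
        · simp only [f, ι, P, z] at hxy
          split_ifs at hxy
          all_goals simp_all
      · simp only [f, P, z] at hxy
        congr 1
        ext
        split_ifs at hxy
        all_goals simp_all
        omega)
  have αι : ∀ x, x ≠ x₀ → α (ι x) = ι (π a x) := fun x hx => by
    rw [hαf _ (by simp [ι, P]) (by simp [ι, P])]; simp [f, ι, hx]
  have αx₀ : α (ι x₀) = P 0 := by
    rw [hαf _ (by simp [ι, P]) (by simp [ι, P])]; simp [f, ι]
  have αP : α (P 0) = z ⟨0, by omega⟩ := by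
    rw [hαf _ (by simp [P]) (by simp [P])]
  have αz : ∀ (i : ℕ) (h : i + 1 < L), α (z ⟨i, by omega⟩) = z ⟨i + 1, h⟩ := fun i h => by
    rw [hαf _ (by simp [z, P]) (by simp [z, P])]; simp [f, z, h]
  have αlast : α (z ⟨L - 1, by omega⟩) = P 1 := by
    rw [hαf _ (by simp [z, P]) (by simp [z, P])]
    simp only [f, z]
    rw [dif_neg (by omega)]
  have αpow : ∀ (j i : ℕ) (h : i + j < L), (α ^ j) (z ⟨i, by omega⟩) = z ⟨i + j, h⟩ := by
    intro j
    induction j with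
    | zero => intro i h; simp
    | succ j ih =>
      intro i h
      rw [pow_succ', Perm.mul_apply, ih i (by omega), αz _ (by omega)]
      rfl
  -- the remaining generators
  let ε : ℤˣ → Perm (Fin 3) := fun s => if s = 1 then finRotate 3 else swap 2 0
  have hε : ∀ s, Perm.sign (ε s) = s := by decide
  have hε2 : ∀ s, ε s 2 = 0 := by decide
  let c : Perm (Fin L) := Fin.cycleRange ⟨M, by omega⟩
  have hMeven : Even M := by
    rw [even_iff_two_dvd]
    exact Nat.dvd_factorial (by norm_num) (by omega)
  have hc1 : Perm.sign c = 1 := by rw [Fin.sign_cycleRange]; exact hMeven.neg_one_pow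
  -- c is a cycle of length M + 1 on the first points of the tail.
  have hcM : c ^ M = c⁻¹ := by
    rw [eq_inv_iff_mul_eq_one, ← pow_succ, ← orderOf_dvd_iff_pow_eq_one, ← Perm.lcm_cycleType,
      Fin.cycleType_cycleRange (by simp [Fin.ext_iff]; omega)]
    simp
  let β : A → Perm (X₀ ⊕ Fin 3) := fun l => sumCongr (π l) (ε (Perm.sign (π l)))
  let σ : A → Perm ((X₀ ⊕ Fin 3) ⊕ Fin L) := fun l => if l = a then α else sumCongr (β l) c
  have σa : σ a = α := if_pos rfl
  have σne : ∀ l, l ≠ a → σ l = sumCongr (β l) c := fun l hl => if_neg hl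
  have σι : ∀ l x, (l, x) ≠ (a, x₀) → σ l (ι x) = ι (π l x) := by
    intro l x hlx
    by_cases hl : l = a
    · subst hl
      rw [σa, αι x (fun h => hlx (by rw [h]))]
    · rw [σne l hl]; simp [ι, β]
  set H := Subgroup.closure (Set.range σ) with hH
  have hσH : ∀ l, σ l ∈ H := fun l => Subgroup.subset_closure ⟨l, rfl⟩
  have hαH : α ∈ H := σa ▸ hσH a
  obtain ⟨b, hba⟩ := exists_ne a
  refine ⟨((X₀ ⊕ Fin 3) ⊕ Fin L), inferInstance, inferInstance, ι, σ, by simp [hm], ?_, σι, ?_, ?_⟩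
  · exact Sum.inl_injective.comp Sum.inl_injective
  · rw [σa, αx₀]; simp [ι, P]
  -- transitivity
  have horb : ∀ l x, x ∈ orbit H (ι x₀) ↔ σ l x ∈ orbit H (ι x₀) := fun l x =>
    by
    constructor
    · rintro ⟨g, rfl⟩
      exact ⟨⟨σ l, hσH l⟩ * g, mul_smul _ _ _⟩
    · rintro ⟨g, hg⟩
      exact ⟨(⟨σ l, hσH l⟩ : H)⁻¹ * g, 
        (mul_smul _ _ _).trans (inv_smul_eq_iff.2 hg)⟩
  have oP0 : P 0 ∈ orbit H (ι x₀) := by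
    rw [← αx₀, ← σa, ← horb]; exact mem_orbit_self _
  have oz : ∀ i (h : i < L), z ⟨i, h⟩ ∈ orbit H (ι x₀) := by
    intro i
    induction i with
    | zero => intro h; rw [← αP, ← σa, ← horb]; exact oP0
    | succ i ih => intro h; rw [← αz i h, ← σa, ← horb]; exact ih _
  have oP1 : P 1 ∈ orbit H (ι x₀) := by rw [← αlast, ← σa, ← horb]; exact oz _ _
  -- A second letter is needed here, since α may fix P 2.
  have oP2 : P 2 ∈ orbit H (ι x₀) := by
    rw [horb b, σne b hba]
    have : sumCongr (β b) c (P 2) = P 0 := by simp [P, β, hε2]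
    rwa [this]
  -- The far end of the removed edge, the only edge along which σ does not follow π.
  have oπ : ι (π a x₀) ∈ orbit H (ι x₀) := by
    obtain ⟨y, hy⟩ := α.surjective (ι (π a x₀))
    rw [← hy, ← σa, ← horb]
    rcases y with (x | i) | i
    · by_cases hx : x = x₀
      · subst hx; exact mem_orbit_self _
      · have h1 : ι (π a x) = ι (π a x₀) := (αι x hx).symm.trans hy
        exact absurd ((π a).injective (Sum.inl_injective (Sum.inl_injective h1))) hx
    · fin_cases i
      · exact oP0
      · exact oP1
      · exact oP2
    · exact oz _ _
  have oι : ∀ x, ι x ∈ orbit H (ι x₀) := by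
    have := hπ {x | ι x ∈ orbit H (ι x₀)} ⟨x₀, mem_orbit_self _⟩ (fun l x => by
      by_cases hlx : (l, x) = (a, x₀)
      · obtain ⟨rfl, rfl⟩ := Prod.mk.inj hlx
        exact iff_of_true (mem_orbit_self _) oπ
      · simp only [Set.mem_ofPred_eq]
        rw [← σι l x hlx]; exact horb l _)
    exact fun x => Set.eq_univ_iff_forall.mp this x
  have : IsPretransitive H ((X₀ ⊕ Fin 3) ⊕ Fin L) := (isPretransitive_iff_base (ι x₀)).2 (by
    rintro ((x | i) | i)
    · exact oι x
    · fin_cases i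
      · exact oP0
      · exact oP1
      · exact oP2
    · exact oz _ _)
  refine le_antisymm ?_ ?_
  · rw [Subgroup.closure_le]
    rintro _ ⟨l, rfl⟩
    change Perm.sign (σ l) = 1
    by_cases hl : l = a
    · rw [hl, σa, hα1]
    · rw [σne l hl, Perm.sign_sumCongr, Perm.sign_sumCongr, hε, hc1, mul_one, Int.units_mul_self]
  -- a cycle supported on an interval
  let C : Perm ((X₀ ⊕ Fin 3) ⊕ Fin L) := sumCongr 1 c
  have hC : C ∈ H := by
    have h1 : σ b ^ M = sumCongr (β b ^ M) (c ^ M) := by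
      rw [σne b hba]
      exact ((Perm.sumCongrHom _ _).map_pow (β b, c) M).symm
    -- M is the order of the symmetric group on `X₀ ⊕ Fin 3`, so the M-th power leaves only the
    -- cycle on the tail.
    have h2 : β b ^ M = 1 := by
      have : Fintype.card (Perm (X₀ ⊕ Fin 3)) = M := by simp [Fintype.card_perm, hM, hm]
      rw [← this, pow_card_eq_one]
    have h3 : C = (σ b ^ M)⁻¹ := by
      rw [h1, h2, hcM, Perm.sumCongr_inv, inv_one, inv_inv]
    rw [h3]
    exact H.inv_mem (H.pow_mem (hσH b) M)
  have hCfix : ∀ y, C y ≠ y → ∃ (j : ℕ) (h : j ≤ M), y = z ⟨j, by omega⟩ := by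
    rintro (y | i) hy
    · exact absurd rfl hy
    · refine ⟨i, ?_, rfl⟩
      by_contra hlt
      refine hy ?_
      simp only [C, sumCongr_apply, Sum.map_inr, c]
      rw [Fin.cycleRange_of_gt (by rw [Fin.lt_def]; exact not_le.mp hlt)]
  have hCM : C (z ⟨M, by omega⟩) = z ⟨0, by omega⟩ := by
    simp only [C, z, sumCongr_apply, Sum.map_inr, c]
    rw [Fin.cycleRange_self]; rfl
  have hC0 : C (z ⟨0, by omega⟩) = z ⟨1, by omega⟩ := by
    simp only [C, z, sumCongr_apply, Sum.map_inr, c]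
    congr 1
    ext
    rw [Fin.coe_cycleRange_of_lt (by rw [Fin.lt_def]; exact hM0)]
  have zinj : ∀ i j (hi : i < L) (hj : j < L), z ⟨i, hi⟩ = z ⟨j, hj⟩ → i = j := fun i j hi hj h =>
    congrArg Fin.val (Sum.inr_injective h)
  let p : ((X₀ ⊕ Fin 3) ⊕ Fin L) := z ⟨M, by omega⟩
  -- C moves only z 0, …, z M, and D only z M, …, z (2M): they share just p, so their commutator is
  -- a 3-cycle.
  let D : Perm ((X₀ ⊕ Fin 3) ⊕ Fin L) := α ^ M * C * (α ^ M)⁻¹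
  have hD : D ∈ H := H.mul_mem (H.mul_mem (H.pow_mem hαH _) hC) (H.inv_mem (H.pow_mem hαH _))
  have hp0 : (α ^ M) (z ⟨0, by omega⟩) = p := by
    rw [αpow M 0 (by omega)]; simp [p]
  have hDp : D p = α p := by
    simp only [D, Perm.mul_apply]
    rw [← hp0, perm_inv_apply_self, hC0, αpow M 1 (by omega), hp0, αz M (by omega)]
    simp [add_comm]
  have hαp : α p ≠ p := by
    simp only [p]
    rw [αz M (by omega)]
    exact fun h => by have := zinj _ _ _ _ h; omega
  have hCp : C p ≠ p := by
    simp only [p]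
    rw [hCM]
    exact fun h => by have := zinj _ _ _ _ h; omega
  have hcomm := commutator_eq_swap_mul_swap (f := C) (g := D) (p := p) hCp (by rwa [hDp]) (by
    intro x hx
    by_contra! hcon
    obtain ⟨i, hi, rfl⟩ := hCfix x hcon.1
    have h1 : C ((α ^ M)⁻¹ (z ⟨i, by omega⟩)) ≠ (α ^ M)⁻¹ (z ⟨i, by omega⟩) := by
      intro h
      apply hcon.2
      simp only [D, Perm.mul_apply]
      rw [h, perm_apply_inv_self]
    obtain ⟨j, hj, h2⟩ := hCfix _ h1
    rw [Perm.inv_eq_iff_eq, αpow M j (by omega)] at h2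
    have h3 := zinj _ _ _ _ h2
    obtain rfl : i = M := by omega
    exact hx rfl)
  rw [hDp] at hcomm
  refine alternatingGroup_le_of_threeCycle H hαH hαp hCp ?_ (hcomm ▸ ?_) (Set.range z) ?_ ?_
  · simp only [p]
    rw [hCM, αz M (by omega)]
    exact fun h => by have := zinj _ _ _ _ h; omega
  · exact H.mul_mem (H.mul_mem (H.mul_mem hC hD) (H.inv_mem hC)) (H.inv_mem hD)
  · rintro _ ⟨i, rfl⟩
    refine ⟨(i : ℤ) - M, ?_⟩
    rw [zpow_sub, ← hp0, Perm.mul_apply, zpow_natCast, zpow_natCast, perm_inv_apply_self,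
      αpow i 0 (by omega)]
    simp
  · rw [← Set.image_univ, Set.ncard_image_of_injective _ Sum.inr_injective, Set.ncard_univ]
    simp [← hm]
    omega

/-! ### Words as lifted paths -/

namespace AGroup

variable {A : Type}

theorem val_cons (G : AGroup A) (x : A × Bool) (w : List (A × Bool)) :
    G.val (FreeGroup.mk (x :: w)) = G.letter x * G.val (FreeGroup.mk w) := by
  rw [letter, val, val, val, ← map_mul, FreeGroup.mul_mk]
  rfl

theorem letter_true (G : AGroup A) (a : A) : G.letter (a, true) = G.gen a := by
  simp [letter, val]

theorem letter_false (G : AGroup A) (a : A) : G.letter (a, false) = (G.gen a)⁻¹ := by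
  simp [letter, val]

/-- A nonempty subset of `G` which is stable under the generators is everything. -/
theorem eq_univ_of_stable (G : AGroup A) {T : Set G.carrier} (hT : T.Nonempty)
    (h : ∀ a x, x ∈ T ↔ x * G.gen a ∈ T) : T = Set.univ := by
  have key : ∀ g x, x ∈ T ↔ x * g ∈ T := by
    intro g
    have hg : g ∈ Subgroup.closure (Set.range G.gen) := by rw [G.closure_gen]; trivial
    induction hg using Subgroup.closure_induction with
    | mem g hg => obtain ⟨a, rfl⟩ := hg; exact h a
    | one => simp
    | mul g k _ _ hg hk => intro x; rw [hg, hk, mul_assoc]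
    | inv g _ hg => intro x; rw [hg (x * g⁻¹), inv_mul_cancel_right]
  obtain ⟨t, ht⟩ := hT
  refine Set.eq_univ_of_forall fun x => ?_
  have := (key (t⁻¹ * x) t).1 ht
  rwa [mul_inv_cancel_left] at this

/-- The vertices of `Ξ` are lifted by `s` to an action of the letters on `X`, along its edges. -/
theorem lift_val {G : AGroup A} {X : Type*} (φ : FreeGroup A →* Equiv.Perm X) (Ξ : G.cayley.Sub)
    (s : G.carrier → X)
    (hs : ∀ a g, (g, (a, true)) ∈ Ξ.edges → (φ (FreeGroup.of a))⁻¹ (s g) = s (g * G.gen a))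
    (u : FreeGroup A) (hu : G.RunsIn u Ξ) : (φ u)⁻¹ (s 1) = s (G.val u) := by
  classical
  have edge : ∀ (x : A × Bool) g, (g, x) ∈ Ξ.edges →
      (φ (FreeGroup.mk [x]))⁻¹ (s g) = s (g * G.letter x) := by
    rintro ⟨a, _ | _⟩ g hg
    · have h1 : (g * (G.gen a)⁻¹, (a, true)) ∈ Ξ.edges := by
        have := Ξ.inv_mem _ hg
        simpa [cayley, letter_false] using this
      have h2 := hs a _ h1
      rw [inv_mul_cancel_right, Equiv.Perm.inv_eq_iff_eq] at h2
      have h3 : (FreeGroup.mk [(a, false)] : FreeGroup A) = (FreeGroup.of a)⁻¹ := by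
        simp [FreeGroup.of, FreeGroup.invRev]
      rw [letter_false, h2, h3, map_inv, inv_inv]
    · rw [letter_true]
      exact hs a g hg
  have path : ∀ (w : List (A × Bool)) g, (∀ e ∈ G.pathFrom g w, e ∈ Ξ.edges) →
      (φ (FreeGroup.mk w))⁻¹ (s g) = s (g * G.val (FreeGroup.mk w)) := by
    intro w
    induction w with
    | nil =>
      intro g _
      rw [← FreeGroup.one_eq_mk]
      simp [val]
    | cons x w ih =>
      intro g hw
      have h1 : (FreeGroup.mk (x :: w) : FreeGroup A) = FreeGroup.mk [x] * FreeGroup.mk w := by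
        rw [FreeGroup.mul_mk]; rfl
      rw [val_cons, h1, map_mul, mul_inv_rev, Equiv.Perm.mul_apply,
        edge x g (hw _ (by simp [pathFrom])),
        ih _ (fun e he => hw e (by simp [pathFrom, he])), mul_assoc]
  have h := path u.toWord 1 (by convert hu.2)
  rwa [FreeGroup.mk_toWord, one_mul] at h

/-! ### Subdirect products -/

/-- The subdirect product of two `A`-generated groups. -/
def prod (H K : AGroup A) : AGroup A where
  carrier := Subgroup.closure (Set.range fun a => ((H.gen a, K.gen a) : H.carrier × K.carrier))
  gen a := ⟨(H.gen a, K.gen a), Subgroup.subset_closure ⟨a, rfl⟩⟩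
  closure_gen := by
    rw [← Subgroup.closure_closure_coe_preimage]
    congr 1
    ext x
    constructor
    · rintro ⟨a, rfl⟩; exact ⟨a, rfl⟩
    · rintro ⟨a, ha⟩; exact ⟨a, Subtype.ext ha⟩

def prodFst (H K : AGroup A) : (H.prod K).carrier →* H.carrier :=
  (MonoidHom.fst _ _).comp (Subgroup.subtype _)

def prodSnd (H K : AGroup A) : (H.prod K).carrier →* K.carrier :=
  (MonoidHom.snd _ _).comp (Subgroup.subtype _)

theorem surjective_of_gen {H G : AGroup A} (χ : H.carrier →* G.carrier)
    (h : ∀ a, χ (H.gen a) = G.gen a) : Function.Surjective χ := by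
  rw [← MonoidHom.range_eq_top, eq_top_iff, ← G.closure_gen, Subgroup.closure_le]
  rintro _ ⟨a, rfl⟩
  exact ⟨_, h a⟩

theorem MapsOnto.val_eq {H G : AGroup A} (h : H.MapsOnto G) {u v : FreeGroup A}
    (huv : H.val u = H.val v) : G.val u = G.val v := by
  obtain ⟨χ, hχ⟩ := h
  have : ∀ w, G.val w = χ (H.val w) := fun w => by
    have : FreeGroup.lift G.gen = χ.comp (FreeGroup.lift H.gen) := by
      ext a; simp [hχ]
    exact DFunLike.congr_fun this w
  rw [this, this, huv]

theorem MapsOnto.trans {H K G : AGroup A} (h : H.MapsOnto K) (k : K.MapsOnto G) :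
    H.MapsOnto G := by
  obtain ⟨χ, hχ⟩ := h
  obtain ⟨ψ, hψ⟩ := k
  exact ⟨ψ.comp χ, fun a => by simp [hχ, hψ]⟩

end AGroup

namespace Formation

open AGroup

variable {A : Type}

theorem prod_mem (𝔉 : Formation) {H K : AGroup A} (hH : H ∈ 𝔉.members A) (hK : K ∈ 𝔉.members A) :
    H.prod K ∈ 𝔉.members A :=
  𝔉.subdirect _ _ _ (prodFst H K) (prodSnd H K) (surjective_of_gen _ fun _ => rfl)
    (surjective_of_gen _ fun _ => rfl)
    (fun _ h₁ h₂ => Subtype.ext (Prod.ext h₁ h₂)) hH hK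

/-- Finitely many properties which are inherited along canonical morphisms, and each of which holds
for some member of the formation, hold for a common member, which maps onto a given one. -/
theorem exists_member_of_forall (𝔉 : Formation) {I : Type*} [Finite I] (P : I → AGroup A → Prop)
    (hP : ∀ i H K, MapsOnto H K → P i K → P i H) (h : ∀ i, ∃ H ∈ 𝔉.members A, P i H)
    {G : AGroup A} (hG : G ∈ 𝔉.members A) :
    ∃ H ∈ 𝔉.members A, H.MapsOnto G ∧ ∀ i, P i H := by
  classical
  have := Fintype.ofFinite I
  suffices ∀ s : Finset I, ∃ H ∈ 𝔉.members A, H.MapsOnto G ∧ ∀ i ∈ s, P i H by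
    simpa using this Finset.univ
  intro s
  induction s using Finset.induction_on with
  | empty => exact ⟨G, hG, ⟨MonoidHom.id _, fun _ => rfl⟩, by simp⟩
  | insert i s _ ih =>
    obtain ⟨H, hH, hHG, hs⟩ := ih
    obtain ⟨K, hK, hi⟩ := h i
    have h1 : (H.prod K).MapsOnto H := ⟨prodFst H K, fun _ => rfl⟩
    have h2 : (H.prod K).MapsOnto K := ⟨prodSnd H K, fun _ => rfl⟩
    refine ⟨H.prod K, 𝔉.prod_mem hH hK, h1.trans hHG, fun j hj => ?_⟩
    rcases Finset.mem_insert.1 hj with rfl | hj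
    · exact hP _ _ _ h2 hi
    · exact hP _ _ _ h1 (hs j hj)

/-- A transitive finite action of the letters is realised, away from one edge, inside an
`A`-generated member of any formation with infinitely many alternating groups. -/
theorem exists_member_extending (𝔉 : Formation)
    (h𝔉 : {n : ℕ | 𝔉.Mem (alternatingGroup (Fin n))}.Infinite) [Nontrivial A] {X₀ : Type}
    [Finite X₀] (π : A → Equiv.Perm X₀)
    (hπ : ∀ S : Set X₀, S.Nonempty → (∀ l x, x ∈ S ↔ π l x ∈ S) → S = Set.univ)
    (a : A) (x₀ : X₀) :
    ∃ H ∈ 𝔉.members A, ∃ (X : Type) (ι : X₀ → X) (θ : H.carrier →* Equiv.Perm X),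
      Function.Injective ι ∧
      (∀ l x, (l, x) ≠ (a, x₀) → (θ (H.gen l))⁻¹ (ι x) = ι (π l x)) ∧
      (θ (H.gen a))⁻¹ (ι x₀) ∉ Set.range ι := by
  have := Fintype.ofFinite X₀
  obtain ⟨N, hN⟩ := exists_alternating_extension π hπ a x₀
  obtain ⟨n, hn, hNn⟩ := h𝔉.exists_gt N
  obtain ⟨X, _, _, ι, σ, hX, hι, hσ, ha, hcl⟩ := hN n hNn.le
  have hmem : ∀ l, (σ l)⁻¹ ∈ alternatingGroup X := fun l =>
    hcl ▸ inv_mem (Subgroup.subset_closure ⟨l, rfl⟩)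
  let H : AGroup A :=
    { carrier := alternatingGroup X
      -- Paths read words from the left while permutations compose from the right; the inverses
      -- reconcile the two.
      gen := fun l => ⟨(σ l)⁻¹, hmem l⟩
      closure_gen := by
        rw [← Subgroup.map_injective (Subgroup.subtype_injective _) |>.eq_iff,
          MonoidHom.map_closure, ← Set.range_comp, ← MonoidHom.range_eq_map,
          Subgroup.range_subtype]
        refine Eq.trans ?_ hcl
        rw [← Subgroup.closure_inv (Set.range σ)]
        congr 1
        ext x
        exact exists_congr fun l => inv_eq_iff_eq_inv }
  refine ⟨H, ?_, X, ι, Subgroup.subtype _, hι, ?_, ?_⟩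
  · let e : Fin n ≃ X := (Fintype.equivFinOfCardEq hX).symm
    exact 𝔉.image _ _ (Equiv.altCongrHom e).toMonoidHom (Equiv.altCongrHom e).surjective hn
  · intro l x hlx
    change ((σ l)⁻¹)⁻¹ (ι x) = _
    rw [inv_inv, hσ l x hlx]
  · change ((σ a)⁻¹)⁻¹ (ι x₀) ∉ _
    rwa [inv_inv]

end Formation

/-! ### Components of subgraphs -/

theorem SerreGraph.IsPath.concat {V E : Type*} {Γ : SerreGraph V E} {p : List E} {u : V} {e : E}
    (h : Γ.IsPath p u (Γ.init e)) : Γ.IsPath (p ++ [e]) u (Γ.term e) := by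
  induction p generalizing u with
  | nil => exact ⟨h.symm, rfl⟩
  | cons x p ih => exact ⟨h.1, ih h.2⟩

theorem SerreGraph.Sub.Joined.concat {V E : Type*} {Γ : SerreGraph V E} {Ξ : Γ.Sub} {u : V} {e : E}
    (h : Ξ.Joined u (Γ.init e)) (he : e ∈ Ξ.edges) : Ξ.Joined u (Γ.term e) := by
  obtain ⟨hu, -, p, hp, hpe⟩ := h
  refine ⟨hu, ?_, p ++ [e], hp.concat, ?_⟩
  · rw [← Γ.init_inv]
    exact Ξ.init_mem _ (Ξ.inv_mem _ he)
  · intro x hx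
    rcases List.mem_append.1 hx with hx | hx
    · exact hpe x hx
    · rwa [List.mem_singleton.1 hx]

theorem SerreGraph.Sub.joined_term_iff {V E : Type*} {Γ : SerreGraph V E} {Ξ : Γ.Sub} {u : V} {e : E}
    (he : e ∈ Ξ.edges) : Ξ.Joined u (Γ.term e) ↔ Ξ.Joined u (Γ.init e) := by
  refine ⟨fun h => ?_, fun h => h.concat he⟩
  have := SerreGraph.Sub.Joined.concat (e := Γ.inv e) (by rwa [Γ.init_inv]) (Ξ.inv_mem _ he)
  rwa [← Γ.init_inv, Γ.inv_inv] at this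

instance {V E : Type*} [Finite V] [Finite E] (Γ : SerreGraph V E) : Finite Γ.Sub :=
  Finite.of_injective (fun Ξ : Γ.Sub => (Ξ.verts, Ξ.edges)) fun Ξ Θ h => by
    cases Ξ; cases Θ; cases h; rfl

/-! ### Twofold covers of the Cayley graph -/

namespace AGroup

variable {A : Type}

/-- The action of the letters on the twofold covering of the Cayley graph with voltages `χ`. -/
def cover (G : AGroup A) (χ : A → G.carrier → Bool) (a : A) : Equiv.Perm (G.carrier × Bool) where
  toFun y := (y.1 * G.gen a, xor y.2 (χ a y.1))
  invFun y := (y.1 * (G.gen a)⁻¹, xor y.2 (χ a (y.1 * (G.gen a)⁻¹)))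
  left_inv y := by simp
  right_inv y := by simp

/-- S meets the fibre over 1, and the lifts of w and v carry that point to both points over g.
Fibres wholly inside S then propagate along all edges. -/
theorem cover_transitive (G : AGroup A) (χ : A → G.carrier → Bool) {w : FreeGroup A}
    {g : G.carrier} {v : FreeGroup A}
    (hw : ∀ i, (FreeGroup.lift (fun a => (G.cover χ a)⁻¹) w)⁻¹ (1, i) = (g, !i))
    (hv : ∀ i, (FreeGroup.lift (fun a => (G.cover χ a)⁻¹) v)⁻¹ (1, i) = (g, i))
    (S : Set (G.carrier × Bool)) (hS : S.Nonempty) (h : ∀ a x, x ∈ S ↔ G.cover χ a x ∈ S) :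
    S = Set.univ := by
  have stable : ∀ w x, x ∈ S ↔ FreeGroup.lift (fun a => (G.cover χ a)⁻¹) w x ∈ S := by
    intro w
    induction w using FreeGroup.induction_on with
    | C1 => simp
    | of a =>
      intro x
      have := h a ((G.cover χ a)⁻¹ x)
      rw [perm_apply_inv_self] at this
      simpa using this.symm
    | inv_of a _ =>
      intro x
      rw [h a x]
      simp
    | mul u v hu hv => intro x; rw [map_mul, Equiv.Perm.mul_apply, hv, hu]
  have stable' : ∀ w x, x ∈ S → (FreeGroup.lift (fun a => (G.cover χ a)⁻¹) w)⁻¹ x ∈ S := by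
    intro w x hx
    rwa [← map_inv, ← stable]
  have h1 : {y : G.carrier | ∃ i, (y, i) ∈ S} = Set.univ := by
    obtain ⟨⟨y, i⟩, hy⟩ := hS
    refine G.eq_univ_of_stable ⟨y, i, hy⟩ fun a x => ⟨?_, ?_⟩
    · rintro ⟨j, hj⟩
      exact ⟨_, (h a _).1 hj⟩
    · rintro ⟨j, hj⟩
      refine ⟨xor j (χ a x), (h a _).2 ?_⟩
      simpa [cover] using hj
  obtain ⟨i, hi⟩ := Set.eq_univ_iff_forall.1 h1 1
  have h2 : {y : G.carrier | ∀ i, (y, i) ∈ S} = Set.univ := by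
    refine G.eq_univ_of_stable ⟨g, fun j => ?_⟩ fun a x => ⟨fun hx j => ?_, fun hx j => ?_⟩
    · by_cases hj : j = i
      · rw [hj, ← hv i]; exact stable' _ _ hi
      · rw [Bool.eq_not_of_ne hj, ← hw i]; exact stable' _ _ hi
    · have := (h a _).1 (hx (xor j (χ a x)))
      simpa [cover] using this
    · exact (h a _).2 (hx _)
  exact Set.eq_univ_of_forall fun x => Set.eq_univ_iff_forall.1 h2 x.1 x.2

end AGroup

/-! ### Dissolving a single constellation, and the main results -/

namespace Formation

open AGroup

variable {A : Type}

open Classical in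
theorem exists_member_dissolves (𝔉 : Formation)
    (h𝔉 : {n : ℕ | 𝔉.Mem (alternatingGroup (Fin n))}.Infinite) [Nontrivial A]
    {G : AGroup A} (hG : G ∈ 𝔉.members A) (Ξ : G.cayley.Sub) (g : G.carrier) (Θ : G.cayley.Sub)
    (hJ : ¬ (Ξ.inter Θ).Joined 1 g) : ∃ H ∈ 𝔉.members A, H.Dissolves G Ξ g Θ := by
  by_cases hex : ∃ u v, G.val u = g ∧ G.val v = g ∧ G.RunsIn u Ξ ∧ G.RunsIn v Θ
  swap
  · exact ⟨G, hG, fun u v hu hv hu' hv' => absurd ⟨u, v, hu, hv, hu', hv'⟩ hex⟩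
  obtain ⟨u, v, hu, hv, hu', hv'⟩ := hex
  let f : G.carrier → Bool := fun y => decide (¬ (Ξ.inter Θ).Joined 1 y)
  have f1 : f 1 = false := by
    simp only [f, decide_eq_false_iff_not, not_not]
    exact ⟨⟨hu'.1, hv'.1⟩, ⟨hu'.1, hv'.1⟩, [], rfl, by simp⟩
  have fg : f g = true := by simpa [f] using hJ
  have fe : ∀ a y, (y, (a, true)) ∈ Ξ.edges → (y, (a, true)) ∈ Θ.edges →
      f (y * G.gen a) = f y := by
    intro a y h₁ h₂
    have := SerreGraph.Sub.joined_term_iff (u := (1 : G.carrier)) (Ξ := Ξ.inter Θ)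
      (e := (y, (a, true))) ⟨h₁, h₂⟩
    simp only [f]
    rw [← G.letter_true]
    exact decide_eq_decide.2 (not_congr this)
  let χ : A → G.carrier → Bool := fun a y =>
    if (y, (a, true)) ∈ Ξ.edges then xor (f y) (f (y * G.gen a)) else false
  have coverΞ : ∀ a y, (y, (a, true)) ∈ Ξ.edges → ∀ i,
      G.cover χ a (y, xor i (f y)) = (y * G.gen a, xor i (f (y * G.gen a))) := by
    intro a y h i
    simp [cover, χ, h]
  have coverΘ : ∀ a y, (y, (a, true)) ∈ Θ.edges → ∀ i,
      G.cover χ a (y, i) = (y * G.gen a, i) := by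
    intro a y h i
    by_cases h' : (y, (a, true)) ∈ Ξ.edges
    · simp [cover, χ, h', fe a y h' h]
    · simp [cover, χ, h']
  have trans := G.cover_transitive χ (w := u) (v := v) (g := g)
    (fun i => by
      have := lift_val (FreeGroup.lift fun a => (G.cover χ a)⁻¹) Ξ (fun y => (y, xor i (f y)))
        (fun a y h => by simpa using coverΞ a y h i) u hu'
      simpa [hu, f1, fg] using this)
    (fun i => by
      have := lift_val (FreeGroup.lift fun a => (G.cover χ a)⁻¹) Θ (fun y => (y, i))
        (fun a y h => by simpa using coverΘ a y h i) v hv'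
      simpa [hv] using this)
  -- If every edge were common to Ξ and Θ, f would be constant, yet f 1 ≠ f g.
  obtain ⟨a, y, hay⟩ : ∃ a y, ¬ ((y, (a, true)) ∈ Ξ.edges ∧ (y, (a, true)) ∈ Θ.edges) := by
    by_contra! hall
    have := G.eq_univ_of_stable (T := {y | f y = false}) ⟨1, f1⟩ fun a y => by
      have := fe a y (hall a y).1 (hall a y).2
      simp [this]
    have := Set.eq_univ_iff_forall.1 this g
    simp [fg] at this
  -- Over an edge of Ξ outside Θ, remove the lift off the graph of f; over an edge outside Ξ, the
  -- lift off the zero section.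
  obtain ⟨x₀, hΞ, hΘ⟩ : ∃ x₀ : G.carrier × Bool,
      (∀ b z, (z, (b, true)) ∈ Ξ.edges → (b, (z, f z)) ≠ (a, x₀)) ∧
      (∀ b z, (z, (b, true)) ∈ Θ.edges → (b, (z, false)) ≠ (a, x₀)) := by
    by_cases h : (y, (a, true)) ∈ Ξ.edges
    · refine ⟨(y, !f y), fun b z _ hbz => ?_, fun b z hz hbz => ?_⟩
      · simp only [Prod.mk.injEq] at hbz
        obtain ⟨-, rfl, h3⟩ := hbz
        simp at h3
      · simp only [Prod.mk.injEq] at hbz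
        obtain ⟨rfl, rfl, -⟩ := hbz
        exact hay ⟨h, hz⟩
    · refine ⟨(y, true), fun b z hz hbz => ?_, fun b z _ hbz => ?_⟩
      · simp only [Prod.mk.injEq] at hbz
        obtain ⟨rfl, rfl, -⟩ := hbz
        exact h hz
      · simp at hbz
  obtain ⟨H, hH, X, ι, θ, hι, hθ, -⟩ := 𝔉.exists_member_extending h𝔉 (G.cover χ) trans a x₀
  refine ⟨H, hH, fun u v hu hv hu' hv' huv => ?_⟩
  have h1 := lift_val (θ.comp (FreeGroup.lift H.gen)) Ξ (fun y => ι (y, f y))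
    (fun b z hz => by
      have := hθ b _ (hΞ b z hz)
      have h := coverΞ b z hz false
      simp only [Bool.false_xor] at h
      simpa [h] using this) u hu'
  have h2 := lift_val (θ.comp (FreeGroup.lift H.gen)) Θ (fun y => ι (y, false))
    (fun b z hz => by
      have := hθ b _ (hΘ b z hz)
      simpa [coverΘ b z hz] using this) v hv'
  have huv' : FreeGroup.lift H.gen u = FreeGroup.lift H.gen v := huv
  simp only [MonoidHom.comp_apply, f1, hu, hv, fg] at h1 h2
  rw [huv', h2] at h1
  simpa using hι h1

/-- If the letter `x` is trivial in `G`, some member of the formation separates `x` from every word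
whose path avoids the loop at `1` labelled `x`. -/
theorem exists_member_separating_loop (𝔉 : Formation)
    (h𝔉 : {n : ℕ | 𝔉.Mem (alternatingGroup (Fin n))}.Infinite) [Nontrivial A]
    (G : AGroup A) (x : A × Bool) (hx : G.letter x = 1) :
    ∃ H ∈ 𝔉.members A, ∀ u : FreeGroup A, G.val u = 1 →
      G.RunsIn u (G.cayley.deleteEdge (1, x)) → H.val u ≠ H.letter x := by
  have hgen : G.gen x.1 = 1 := by
    rcases x with ⟨a, _ | _⟩
    · simpa [letter_false] using hx
    · simpa [letter_true] using hx
  obtain ⟨H, hH, X, ι, θ, hι, hθ, ha⟩ := 𝔉.exists_member_extending h𝔉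
    (fun a => Equiv.mulRight (G.gen a)) (fun S hS h => G.eq_univ_of_stable hS h) x.1 1
  -- The path of u lifts to a closed path at ι 1, so `x`, with the same value as u, would fix ι 1,
  -- although its generator's edge there leaves the range of ι.
  refine ⟨H, hH, fun u hu hu' huv => ha ⟨1, ?_⟩⟩
  have h1 := lift_val (θ.comp (FreeGroup.lift H.gen)) _ ι
    (fun b z hz => by
      have := hθ b z fun h => by
        obtain ⟨rfl, rfl⟩ := Prod.mk.inj h
        rcases x with ⟨a, _ | _⟩
        · exact hz.2 (by simp [cayley, hx])
        · exact hz.1 rfl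
      simpa using this) u hu'
  have h2 : FreeGroup.lift H.gen u = H.letter x := huv
  rw [MonoidHom.comp_apply, h2, hu] at h1
  rcases x with ⟨a, _ | _⟩
  · rw [letter_false, map_inv, inv_inv] at h1
    exact (Equiv.Perm.inv_eq_iff_eq.2 h1.symm).symm
  · rw [letter_true] at h1
    exact h1.symm

theorem arboreous_of_infinite (𝔉 : Formation)
    (h𝔉 : {n : ℕ | 𝔉.Mem (alternatingGroup (Fin n))}.Infinite) : 𝔉.Arboreous := by
  intro A _ _ G hG
  obtain ⟨H, hH, hHG, h⟩ := 𝔉.exists_member_of_forall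
    (I := G.cayley.Sub × G.carrier × G.cayley.Sub)
    (fun i H => G.cayley.IsConstellation 1 i.1 i.2.1 i.2.2 → H.Dissolves G i.1 i.2.1 i.2.2)
    (fun i H K hHK hK hi u v hu hv hu' hv' huv => hK hi u v hu hv hu' hv' (hHK.val_eq huv))
    (fun i => by
      by_cases hi : G.cayley.IsConstellation 1 i.1 i.2.1 i.2.2
      · obtain ⟨H, hH, h⟩ := 𝔉.exists_member_dissolves h𝔉 hG _ _ _ hi.2.2.2.2
        exact ⟨H, hH, fun _ => h⟩
      · exact ⟨G, hG, fun h => absurd h hi⟩) hG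
  exact ⟨H, hH, fun Ξ g Θ hc => h (Ξ, g, Θ) hc, hHG⟩

theorem hall_of_infinite (𝔉 : Formation)
    (h𝔉 : {n : ℕ | 𝔉.Mem (alternatingGroup (Fin n))}.Infinite) : 𝔉.Hall := by
  intro A _ _ G hG
  obtain ⟨H, hH, hHG, h⟩ := 𝔉.exists_member_of_forall (I := A × Bool)
    (fun a H => (G.letter a ≠ 1 →
      H.Dissolves G (G.cayley.deleteEdge (1, a)) (G.letter a) (G.cayley.edgeSub (1, a))) ∧
      (G.letter a = 1 → ∀ u : FreeGroup A, G.val u = 1 →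
        G.RunsIn u (G.cayley.deleteEdge (1, a)) → H.val u ≠ H.letter a))
    (fun a H K hHK hK =>
      ⟨fun ha u v hu hv hu' hv' huv => hK.1 ha u v hu hv hu' hv' (hHK.val_eq huv),
        fun ha u hu hu' huv => hK.2 ha u hu hu' (hHK.val_eq huv)⟩)
    (fun a => by
      by_cases ha : G.letter a = 1
      · obtain ⟨H, hH, h⟩ := 𝔉.exists_member_separating_loop h𝔉 G a ha
        exact ⟨H, hH, fun h => absurd ha h, fun _ => h⟩
      · obtain ⟨H, hH, h⟩ := 𝔉.exists_member_dissolves h𝔉 hG (G.cayley.deleteEdge (1, a))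
          (G.letter a) (G.cayley.edgeSub (1, a)) (by
            -- The intersection has no edges at all, so only the empty path could join 1 to the
            -- letter.
            rintro ⟨-, -, p, hp, hpe⟩
            cases p with
            | nil => exact ha hp.symm
            | cons e p =>
              obtain ⟨h1, h2⟩ := hpe e (by simp)
              rcases h2 with h2 | h2
              · exact h1.1 h2
              · exact h1.2 h2)
        exact ⟨H, hH, fun _ => h, fun h => absurd h ha⟩) hG
  exact ⟨H, hH, h, hHG⟩

theorem infinite_setOf_mem_alternatingGroup (𝔉 : Formation) {k : ℕ → ℕ} (hk : StrictMono k)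
    (h : ∀ n, 𝔉.Mem (alternatingGroup (Fin (k n)))) :
    {n : ℕ | 𝔉.Mem (alternatingGroup (Fin n))}.Infinite :=
  (Set.infinite_range_of_injective hk.injective).mono (by rintro _ ⟨n, rfl⟩; exact h n)

theorem evenAlternating_mem (n : ℕ) :
    evenAlternating.Mem (alternatingGroup (Fin (2 * (n + 3)))) :=
  fun _ h => h _ ⟨n + 3, by omega, ⟨MulEquiv.refl _⟩⟩

theorem oddAlternating_mem (n : ℕ) :
    oddAlternating.Mem (alternatingGroup (Fin (2 * (n + 2) + 1))) :=
  fun _ h => h _ ⟨n + 2, by omega, ⟨MulEquiv.refl _⟩⟩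

theorem join_evenAlternating_oddAlternating_mem (n : ℕ) :
    (evenAlternating.join oddAlternating).Mem (alternatingGroup (Fin (2 * (n + 3)))) :=
  fun _ h => h _ (Or.inl (evenAlternating_mem n))

end Formation

theorem mainTheorem2 :
    (∀ 𝔉 : Formation, {n : ℕ | 𝔉.Mem (alternatingGroup (Fin n))}.Infinite →
      𝔉.Arboreous ∧ 𝔉.Hall) ∧
    Formation.evenAlternating.Arboreous ∧
    Formation.oddAlternating.Arboreous ∧
    (Formation.evenAlternating.join Formation.oddAlternating).Arboreous := by
  refine ⟨fun 𝔉 h => ⟨𝔉.arboreous_of_infinite h, 𝔉.hall_of_infinite h⟩, ?_, ?_, ?_⟩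
  · exact Formation.arboreous_of_infinite _ (Formation.infinite_setOf_mem_alternatingGroup _
      (strictMono_nat_of_lt_succ fun n => by omega) Formation.evenAlternating_mem)
  · exact Formation.arboreous_of_infinite _ (Formation.infinite_setOf_mem_alternatingGroup _
      (strictMono_nat_of_lt_succ fun n => by omega) Formation.oddAlternating_mem)
  · exact Formation.arboreous_of_infinite _ (Formation.infinite_setOf_mem_alternatingGroup _
      (strictMono_nat_of_lt_succ fun n => by omega)
      Formation.join_evenAlternating_oddAlternating_mem)
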